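/- Let $s\ge 1$, let $\mathbf M$ be an irreducible $s\times s$ matrix with entries in $\{0,1\}$ (for all $i,j$ there is $n\ge1$ with $(\mathbf M^n)(i,j)>0$), and fix $\lambda\in(0,1)$. Let $\Sigma=\{x=(x_0,x_1,\dots):\mathbf M(x_j,x_{j+1})=1\ \forall j\ge0\}$ be the one-sided subshift of finite type with the distance $d(x,x')=\lambda^{\min\{j:\,x_j\ne x'_j\}}$ (and $d(x,x)=0$), let $\Sigma^*=\{y=(\dots,y_2,y_1):\mathbf M(y_{j+1},y_j)=1\ \forall j\ge1\}$ with the analogous distance, and let $\hat\Sigma=\{(y,x)\in\Sigma^*\times\Sigma:\mathbf M(y_1,x_0)=1\}$ with the maximum of the two distances. Put $\pi(y,x)=x$ and $\tau(y,x)=(y_1,x_0,x_1,\dots)$. Let $A:\hat\Sigma\to\mathbb R$ be Hölder continuous. Let $\bar A=\min_{\hat\mu}\int A\,d\hat\mu$ over all Borel probability measures $\hat\mu$ on $\hat\Sigma$ that are holonomic, i.e. $\int f\circ\tau\,d\hat\mu=\int f\circ\pi\,d\hat\mu$ for all continuous $f:\Sigma\to\mathbb R$. A continuous $u:\Sigma\to\mathbb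 R$ is a sub-action if $u(\pi(z))-u(\tau(z))\le A(z)-\bar A$ for all $z\in\hat\Sigma$; a sub-action $u$ is calibrated if $u(x)=\min_{z\in\hat\Sigma,\ \pi(z)=x}\,[u(\tau(z))+A(z)-\bar A]$ for all $x\in\Sigma$. For $x,x'\in\Sigma$, $\varepsilon>0$ and $k\ge1$ let $\mathcal P_k(x,x',\varepsilon)$ be the set of all $(z^0,\dots,z^k)\in\hat\Sigma^{k+1}$ with $\pi(z^{i})=\tau(z^{i+1})$ for $0\le i<k$, $d(\pi(z^0),x)<\varepsilon$ and $d(\pi(z^k),x')<\varepsilon$. Let $\Omega(A)$ be the set of all $x\in\Sigma$ such that for every $\varepsilon>0$ there are $k\ge1$ and $(z^0,\dots,z^k)\in\mathcal P_k(x,x,\varepsilon)$ with $\bigl|\sum_{i=1}^k(A(z^i)-\bar A)\bigr|<\varepsilon$. The Peierls barrier is $$h_A(x,x')=\lim_{\varepsilon\to0}\ \liminf_{k\to\infty}\ \inf\Bigl\{\sum_{i=1}^k(A(z^i)-\bar A)\ :\ (z^0,\dots,z^k)\in\mathcal P_k(x,x',\varepsilon)\Bigr\},\qquad \inf\emptyset=+\infty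 .$$ The irreducible components are the equivalence classes in $\Omega(A)$ of the relation $h_A(x,x')+h_A(x',x)=0$. Let $v$ be a continuous sub-action and $u$ a continuous calibrated sub-action for $A$. Then: 1. $u-v$ is constant on every irreducible component, the minima of $u-v$ over $\Sigma$ and over $\Omega(A)$ exist, and $\min_\Sigma(u-v)=\min_{\Omega(A)}(u-v)$. 2. Suppose that $\Omega(A)=C_1\sqcup\dots\sqcup C_r$ is a finite union of disjoint irreducible components, that $C_{i_1}$ is the only one of these components on which $\min_\Sigma(u-v)$ is attained, and that no $C_i$ with $i\ne i_1$ is a local minimum of $u-v$, i.e. every neighbourhood of $C_i$ contains a point at which $u-v$ is smaller than its constant value on $C_i$. Then for every $\bar x\in C_{i_1}$, $$u(x)=u(\bar x)+h_A(\bar x,x)\qquad\text{for all }x\in\Sigma .$$ -/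

import Mathlib

open Filter Topology MeasureTheory

namespace SFT

/-- `M` is a `0`-`1` matrix. -/
def IsTransitionMatrix {s : ℕ} (M : Matrix (Fin s) (Fin s) ℕ) : Prop :=
  ∀ i j, M i j = 0 ∨ M i j = 1

/-- Every state can be reached from every state in a positive number of steps. -/
def IsIrreducible {s : ℕ} (M : Matrix (Fin s) (Fin s) ℕ) : Prop :=
  ∀ i j, ∃ n : ℕ, 1 ≤ n ∧ 0 < (M ^ n) i j

/-- The one-sided subshift of finite type `Σ`; its points are `(x₀, x₁, …)`.  It carries the
topology (and the Borel σ-algebra) of a subspace of the product of discrete spaces. -/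
abbrev Shift {s : ℕ} (M : Matrix (Fin s) (Fin s) ℕ) : Type :=
  {x : ℕ → Fin s // ∀ j, M (x j) (x (j + 1)) = 1}

/-- The dual subshift `Σ*`; its points are the pasts `(…, y₃, y₂, y₁)`, and the letter `y_{j+1}`
is stored at the index `j`. -/
abbrev Dual {s : ℕ} (M : Matrix (Fin s) (Fin s) ℕ) : Type :=
  {y : ℕ → Fin s // ∀ j, M (y (j + 1)) (y j) = 1}

/-- The natural extension: the pairs `(y, x) = (…, y₂, y₁ | x₀, x₁, …)` with `M(y₁, x₀) = 1`. -/
abbrev NatExt {s : ℕ} (M : Matrix (Fin s) (Fin s) ℕ) : Type :=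
  {z : Dual M × Shift M // M (z.1.1 0) (z.2.1 0) = 1}

variable {s : ℕ} {M : Matrix (Fin s) (Fin s) ℕ}

/-- The σ-algebra of the natural extension is its Borel σ-algebra. -/
instance instBorelSpaceNatExt : BorelSpace (NatExt M) := by
  have : SecondCountableTopology (Fin s) := DiscreteTopology.secondCountableTopology_of_countable
  have : SecondCountableTopology (Shift M) :=
    TopologicalSpace.Subtype.secondCountableTopology _
  exact Subtype.borelSpace {z : Dual M × Shift M | M (z.1.1 0) (z.2.1 0) = 1}

/-- The canonical projection `π(y, x) = x`. -/
def proj (z : NatExt M) : Shift M := z.1.2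

/-- The inverse branch `τ(y, x) = τ_y(x) = (y₁, x₀, x₁, …)`. -/
def tau (z : NatExt M) : Shift M :=
  ⟨fun n => Nat.casesOn n (z.1.1.1 0) z.1.2.1, fun j => by
    cases j with
    | zero => exact z.2
    | succ k => exact z.1.2.2 k⟩

/-- `lam ^ k` where `k` is the first index at which the two sequences differ, and `0` if they
are equal. -/
noncomputable def seqDist (lam : ℝ) (x x' : ℕ → Fin s) : ℝ :=
  open Classical in if x = x' then 0 else lam ^ PiNat.firstDiff x x'

/-- The distance of `Σ`. -/
noncomputable def shiftDist (lam : ℝ) (x x' : Shift M) : ℝ := seqDist lam x.1 x'.1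

/-- The distance of the natural extension, as a subset of the product `Σ* × Σ`. -/
noncomputable def natExtDist (lam : ℝ) (z z' : NatExt M) : ℝ :=
  max (seqDist lam z.1.1.1 z'.1.1.1) (seqDist lam z.1.2.1 z'.1.2.1)

/-- `A` is Hölder continuous (with some positive exponent). -/
def IsHolder (lam : ℝ) (A : NatExt M → ℝ) : Prop :=
  ∃ θ : ℝ, 0 < θ ∧ ∃ K : ℝ, ∀ z z', |A z - A z'| ≤ K * natExtDist lam z z' ^ θ

/-- Holonomic probability measures on the natural extension. -/
def IsHolonomic (μ : Measure (NatExt M)) : Prop :=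
  IsProbabilityMeasure μ ∧
    ∀ f : Shift M → ℝ, Continuous f → ∫ z, f (tau z) ∂μ = ∫ z, f (proj z) ∂μ

/-- The holonomic minimizing value `Ā`. -/
noncomputable def minValue (A : NatExt M → ℝ) : ℝ :=
  sInf {a | ∃ μ : Measure (NatExt M), IsHolonomic μ ∧ a = ∫ z, A z ∂μ}

/-- `u` is a continuous sub-action for `A`. -/
def IsSubaction (A : NatExt M → ℝ) (u : Shift M → ℝ) : Prop :=
  Continuous u ∧ ∀ z, u (proj z) - u (tau z) ≤ A z - minValue A

/-- `u` is a continuous calibrated sub-action for `A`: for every `x`, the value `u x` is the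
minimum of `u (τ_y x) + A (y, x) - Ā` over all `y` with `(y, x)` in the natural extension. -/
def IsCalibrated (A : NatExt M → ℝ) (u : Shift M → ℝ) : Prop :=
  IsSubaction A u ∧
    ∀ x, IsLeast {a | ∃ z : NatExt M, proj z = x ∧ a = u (tau z) + A z - minValue A} (u x)

/-- `(z⁰, …, z^k)` is a path that begins within `ε` of `x` and ends within `ε` of `x'`. -/
def IsPath (lam : ℝ) (k : ℕ) (x x' : Shift M) (ε : ℝ) (z : Fin (k + 1) → NatExt M) : Prop :=
  (∀ i : Fin k, proj (z i.castSucc) = tau (z i.succ)) ∧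
    shiftDist lam (proj (z 0)) x < ε ∧ shiftDist lam (proj (z (Fin.last k))) x' < ε

/-- The sum of `A - Ā` over `z¹, …, z^k`. -/
noncomputable def action (A : NatExt M → ℝ) (k : ℕ) (z : Fin (k + 1) → NatExt M) : ℝ :=
  ∑ i : Fin k, (A (z i.succ) - minValue A)

/-- The set `Ω(A)` of non-wandering points with respect to `A`. -/
def nonwandering (lam : ℝ) (A : NatExt M → ℝ) : Set (Shift M) :=
  {x | ∀ ε : ℝ, 0 < ε → ∃ k : ℕ, 1 ≤ k ∧ ∃ z : Fin (k + 1) → NatExt M,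
    IsPath lam k x x ε z ∧ |action A k z| < ε}

/-- The infimum of the actions of the paths of length `k` that begin within `ε` of `x` and end
within `ε` of `x'` (it is `+∞` if there is no such path). -/
noncomputable def minAction (lam : ℝ) (A : NatExt M → ℝ) (ε : ℝ) (x x' : Shift M) (k : ℕ) :
    EReal :=
  ⨅ (z : Fin (k + 1) → NatExt M) (_ : IsPath lam k x x' ε z), (action A k z : EReal)

/-- The Peierls barrier `h_A(x, x')`.  The lower limit increases as `ε` decreases, so that its
limit for `ε → 0` is the supremum over `ε > 0` (see `tendsto_peierls`). -/
noncomputable def peierls (lam : ℝ) (A : NatExt M → ℝ) (x x' : Shift M) : EReal :=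
  ⨆ (ε : ℝ) (_ : 0 < ε), liminf (fun k => minAction lam A ε x x' k) atTop

theorem tendsto_peierls (lam : ℝ) (A : NatExt M → ℝ) (x x' : Shift M) :
    Tendsto (fun ε : ℝ => liminf (fun k => minAction lam A ε x x' k) atTop) (𝓝[>] 0)
      (𝓝 (peierls lam A x x')) := by
  have hanti : Antitone fun ε : ℝ => liminf (fun k => minAction lam A ε x x' k) atTop := by
    intro ε ε' hle
    refine liminf_le_liminf (Eventually.of_forall fun k => ?_)
    refine le_iInf₂ fun z hz => iInf₂_le z ?_
    exact ⟨hz.1, hz.2.1.trans_le hle, hz.2.2.trans_le hle⟩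
  rw [tendsto_order]
  constructor
  · intro a ha
    obtain ⟨ε, hε⟩ := lt_iSup_iff.1 ha
    obtain ⟨hpos, hε⟩ := lt_iSup_iff.1 hε
    filter_upwards [Ioo_mem_nhdsGT hpos] with ε' hε'
    exact hε.trans_le (hanti hε'.2.le)
  · intro a ha
    filter_upwards [self_mem_nhdsWithin] with ε hε
    exact (le_iSup₂ (f := fun (ε : ℝ) (_ : 0 < ε) =>
      liminf (fun k => minAction lam A ε x x' k) atTop) ε hε).trans_lt ha

/-- `C` is an irreducible component: an equivalence class in `Ω(A)` of the relation
`h_A(x, x') + h_A(x', x) = 0`. -/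
def IsComponent (lam : ℝ) (A : NatExt M → ℝ) (C : Set (Shift M)) : Prop :=
  ∃ x ∈ nonwandering lam A,
    C = {x' ∈ nonwandering lam A | peierls lam A x x' + peierls lam A x' x = 0}

/-- The set `C` is a local minimum of `f`: on some neighbourhood of `C`, the function `f` is
nowhere smaller than on `C`. -/
def IsLocalMinSet (f : Shift M → ℝ) (C : Set (Shift M)) : Prop :=
  ∃ U : Set (Shift M), IsOpen U ∧ C ⊆ U ∧ ∀ x ∈ C, ∀ x' ∈ U, f x ≤ f x'

end SFT

/-! A sub-action telescopes along paths, so `u x' - u x ≤ h_A(x, x')`; everything rests on finding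
pairs where equality holds. The predicate `CostLE` expresses an upper bound on `h_A` by explicit
paths and cylinders (`peierls_le_coe_iff`). Since `τ` contracts and `A` is Hölder, paths can be
concatenated at small cost (`exists_shadowing`), which gives the triangle inequality `CostLE.trans`.

For calibrated `u`, the backward orbit of minimizers from `x` has telescoping equality, and `u - v`
does not increase along it. Its limit points lie in `Ω(A)` and realize equality to `x`
(`IsCalibrated.exists_nonwandering`). So `Ω(A)` already carries the minimum of `u - v`.

For part 2, take a source component of `x` with the least value of `u - v`. If it is not `C i₁`, it
is not a local minimum: points arbitrarily near it have sources of strictly smaller value. By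
closedness and finiteness, so does a point of the component itself, and by transitivity so does `x`,
a contradiction. -/

namespace SFT

variable {s : ℕ} {M : Matrix (Fin s) (Fin s) ℕ}

/-! ### Cylinders, compactness and nonemptiness of the shift -/

section Cylinders

variable {lam : ℝ}

theorem seqDist_le_pow (h0 : 0 < lam) (h1 : lam < 1) {n : ℕ} {x x' : ℕ → Fin s}
    (h : ∀ i < n, x i = x' i) : seqDist lam x x' ≤ lam ^ n := by
  unfold seqDist
  split_ifs with hx
  · positivity
  · refine pow_le_pow_of_le_one h0.le h1.le ?_
    by_contra hlt
    exact PiNat.apply_firstDiff_ne hx (h _ (not_le.1 hlt))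

theorem eq_of_seqDist_lt_pow (h0 : 0 < lam) (h1 : lam < 1) {n : ℕ} {x x' : ℕ → Fin s}
    (h : seqDist lam x x' < lam ^ n) : ∀ i < n, x i = x' i := by
  intro i hi
  unfold seqDist at h
  split_ifs at h with hx
  · rw [hx]
  · refine PiNat.apply_eq_of_lt_firstDiff (hi.trans ?_)
    exact (pow_lt_pow_iff_right_of_lt_one₀ h0 h1).1 h

/-- The first `n` letters of `x` and `x'` are the same. -/
def Agree (n : ℕ) (x x' : Shift M) : Prop := ∀ i < n, x.1 i = x'.1 i

theorem Agree.refl (n : ℕ) (x : Shift M) : Agree n x x := fun _ _ => rfl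

theorem Agree.symm {n : ℕ} {x x' : Shift M} (h : Agree n x x') : Agree n x' x :=
  fun i hi => (h i hi).symm

theorem Agree.trans {n : ℕ} {x x' x'' : Shift M} (h : Agree n x x') (h' : Agree n x' x'') :
    Agree n x x'' :=
  fun i hi => (h i hi).trans (h' i hi)

theorem Agree.mono {m n : ℕ} (hmn : m ≤ n) {x x' : Shift M} (h : Agree n x x') :
    Agree m x x' :=
  fun i hi => h i (hi.trans_le hmn)

theorem isOpen_setOf_agree (n : ℕ) (x : Shift M) : IsOpen {x' : Shift M | Agree n x' x} := by
  have : {x' : Shift M | Agree n x' x} = ⋂ i ∈ Set.Iio n, {x' : Shift M | x'.1 i = x.1 i} := by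
    ext x'; simp [Agree]
  rw [this]
  refine (Set.finite_Iio n).isOpen_biInter fun i _ => ?_
  have hcont : Continuous fun x' : Shift M => x'.1 i :=
    (continuous_apply i).comp continuous_subtype_val
  exact (isOpen_discrete ({x.1 i} : Set (Fin s))).preimage hcont

theorem eventually_agree (n : ℕ) (x : Shift M) : ∀ᶠ x' in 𝓝 x, Agree n x' x :=
  (isOpen_setOf_agree n x).mem_nhds (Agree.refl n x)

theorem exists_agree_of_eventually {x : Shift M} {P : Shift M → Prop} (h : ∀ᶠ x' in 𝓝 x, P x') :
    ∃ n, ∀ x', Agree n x' x → P x' := by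
  obtain ⟨U, hU, hUP⟩ := mem_nhds_subtype _ _ _ |>.1 h
  obtain ⟨C, ⟨y, n, rfl⟩, hx, hC⟩ :=
    (PiNat.isTopologicalBasis_cylinders (fun _ : ℕ => Fin s)).mem_nhds_iff.1 hU
  refine ⟨n, fun x' hx' => hUP (hC ?_)⟩
  rw [PiNat.mem_cylinder_iff] at hx ⊢
  intro i hi
  rw [hx' i hi, hx i hi]

theorem exists_agree_abs_sub_lt {u : Shift M → ℝ} (hu : Continuous u) (x : Shift M) {δ : ℝ}
    (hδ : 0 < δ) : ∃ n, ∀ x', Agree n x' x → |u x' - u x| < δ :=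
  exists_agree_of_eventually (Metric.tendsto_nhds.1 hu.continuousAt δ hδ)

instance instCompactSpaceShift : CompactSpace (Shift M) := by
  refine isCompact_iff_compactSpace.1 (IsClosed.isCompact ?_)
  change IsClosed {x : ℕ → Fin s | ∀ j, M (x j) (x (j + 1)) = 1}
  rw [Set.ofPred_forall]
  refine isClosed_iInter fun j => ?_
  have hcont : Continuous fun x : ℕ → Fin s => (x j, x (j + 1)) :=
    (continuous_apply j).prodMk (continuous_apply (j + 1))
  exact (isClosed_discrete {p : Fin s × Fin s | M p.1 p.2 = 1}).preimage hcont

theorem exists_successor (hM : IsTransitionMatrix M) (hirr : IsIrreducible M) (i : Fin s) :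
    ∃ j, M i j = 1 := by
  obtain ⟨n, hn, hpos⟩ := hirr i i
  obtain ⟨m, rfl⟩ := Nat.exists_eq_add_of_le' hn
  rw [pow_succ', Matrix.mul_apply] at hpos
  obtain ⟨j, -, hj⟩ := Finset.exists_ne_zero_of_sum_ne_zero hpos.ne'
  exact ⟨j, (hM i j).resolve_left (left_ne_zero_of_mul hj)⟩

theorem nonempty_shift (hs : 1 ≤ s) (hM : IsTransitionMatrix M) (hirr : IsIrreducible M) :
    Nonempty (Shift M) := by
  choose g hg using exists_successor hM hirr
  refine ⟨⟨fun n => g^[n] ⟨0, hs⟩, fun j => ?_⟩⟩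
  have hj : g^[j + 1] ⟨0, hs⟩ = g (g^[j] ⟨0, hs⟩) := Function.iterate_succ_apply' _ _ _
  change M (g^[j] ⟨0, hs⟩) (g^[j + 1] ⟨0, hs⟩) = 1
  rw [hj]
  exact hg _

end Cylinders

/-! ### Paths, their actions and the Peierls barrier -/

section Paths

/-- `z 0, …, z k` is a path. -/
def IsChain (k : ℕ) (z : ℕ → NatExt M) : Prop := ∀ i < k, proj (z i) = tau (z (i + 1))

/-- The sum of `A - Ā` over `z 1, …, z k`. -/
noncomputable def chainAction (A : NatExt M → ℝ) (k : ℕ) (z : ℕ → NatExt M) : ℝ :=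
  ∑ i ∈ Finset.range k, (A (z (i + 1)) - minValue A)

/-- There are arbitrarily long paths, beginning arbitrarily close to `x` and ending arbitrarily
close to `x'`, whose action is not much larger than `a`. -/
def CostLE (A : NatExt M → ℝ) (x x' : Shift M) (a : ℝ) : Prop :=
  ∀ n N : ℕ, ∀ δ : ℝ, 0 < δ → ∃ k ≥ N, ∃ z : ℕ → NatExt M, IsChain k z ∧
    Agree n (proj (z 0)) x ∧ Agree n (proj (z k)) x' ∧ chainAction A k z < a + δ

variable {A : NatExt M → ℝ} {lam : ℝ}

theorem IsChain.isPath (h0 : 0 < lam) (h1 : lam < 1) {k n : ℕ} {z : ℕ → NatExt M}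
    (hz : IsChain k z) {x x' : Shift M} (hx : Agree n (proj (z 0)) x)
    (hx' : Agree n (proj (z k)) x') {ε : ℝ} (hε : lam ^ n < ε) :
    IsPath lam k x x' ε fun i => z i := by
  refine ⟨fun i => ?_, (seqDist_le_pow h0 h1 hx).trans_lt hε, ?_⟩
  · simpa using hz i i.2
  · exact (seqDist_le_pow h0 h1 hx').trans_lt hε

/-- The path `z 0, …, z k` followed by `w 1, w 2, …`. -/
def join (k : ℕ) (z w : ℕ → NatExt M) (i : ℕ) : NatExt M := if i ≤ k then z i else w (i - k)

theorem join_of_le {k i : ℕ} (h : i ≤ k) (z w : ℕ → NatExt M) : join k z w i = z i := if_pos h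

theorem join_add_succ (k i : ℕ) (z w : ℕ → NatExt M) : join k z w (k + i + 1) = w (i + 1) := by
  rw [join, if_neg (by omega), show k + i + 1 - k = i + 1 by omega]

theorem proj_join_add {k : ℕ} {z w : ℕ → NatExt M} (h : proj (z k) = proj (w 0)) (i : ℕ) :
    proj (join k z w (k + i)) = proj (w i) := by
  cases i with
  | zero => rw [add_zero, join_of_le le_rfl, h]
  | succ i => rw [← add_assoc, join_add_succ]

theorem IsChain.join {k l : ℕ} {z w : ℕ → NatExt M} (hz : IsChain k z) (hw : IsChain l w)
    (h : proj (z k) = proj (w 0)) : IsChain (k + l) (join k z w) := by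
  intro i hi
  rcases lt_or_ge i k with hik | hik
  · rw [join_of_le hik.le, join_of_le hik, hz i hik]
  · obtain ⟨j, rfl⟩ := Nat.exists_eq_add_of_le hik
    rw [proj_join_add h, join_add_succ, hw j (by omega)]

theorem chainAction_join (k l : ℕ) (z w : ℕ → NatExt M) :
    chainAction A (k + l) (join k z w) = chainAction A k z + chainAction A l w := by
  unfold chainAction
  rw [Finset.sum_range_add]
  congr 1
  · exact Finset.sum_congr rfl fun i hi => by rw [join_of_le (Finset.mem_range.1 hi)]
  · exact Finset.sum_congr rfl fun i _ => by rw [join_add_succ]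

theorem action_eq_chainAction (k : ℕ) (z : ℕ → NatExt M) :
    action A k (fun i => z i) = chainAction A k z := by
  simp [action, chainAction, Finset.sum_range]

theorem IsPath.exists_chain (h0 : 0 < lam) (h1 : lam < 1) {k n : ℕ} {x x' : Shift M}
    {z : Fin (k + 1) → NatExt M} (hz : IsPath lam k x x' (lam ^ n) z) :
    ∃ z' : ℕ → NatExt M, IsChain k z' ∧ Agree n (proj (z' 0)) x ∧ Agree n (proj (z' k)) x' ∧
      chainAction A k z' = action A k z := by
  have hext : (fun i : Fin (k + 1) => z (Fin.ofNat (k + 1) i)) = z := by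
    funext i; simp
  have hlast : Fin.ofNat (k + 1) k = Fin.last k := by ext; simp
  refine ⟨fun i => z (Fin.ofNat (k + 1) i), fun i hi => ?_, ?_, ?_, ?_⟩
  · have := hz.1 ⟨i, hi⟩
    convert this using 3 <;> ext <;> simp <;> omega
  · exact eq_of_seqDist_lt_pow h0 h1 hz.2.1
  · have := eq_of_seqDist_lt_pow h0 h1 hz.2.2
    rwa [← hlast] at this
  · rw [← action_eq_chainAction, hext]

theorem peierls_le_coe_iff (h0 : 0 < lam) (h1 : lam < 1) {x x' : Shift M} {a : ℝ} :
    peierls lam A x x' ≤ (a : EReal) ↔ CostLE A x x' a := by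
  unfold peierls minAction CostLE
  have hlim (ε : ℝ) := liminf_le_iff (f := atTop) (x := (a : EReal))
    (u := fun k => ⨅ (z : Fin (k + 1) → NatExt M) (_ : IsPath lam k x x' ε z),
      (action A k z : EReal))
  simp only [iSup_le_iff, hlim, iInf_lt_iff, Filter.frequently_atTop, exists_prop]
  constructor
  · intro h n N δ hδ
    obtain ⟨k, hk, z, hz, hzδ⟩ := h (lam ^ n) (by positivity) ((a + δ : ℝ) : EReal)
      (EReal.coe_lt_coe_iff.2 (by linarith)) N
    obtain ⟨z', hz', hx, hx', heq⟩ := hz.exists_chain (A := A) h0 h1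
    exact ⟨k, hk, z', hz', hx, hx', heq ▸ EReal.coe_lt_coe_iff.1 hzδ⟩
  · intro h ε hε b hb N
    obtain ⟨c, hac, hcb⟩ := EReal.lt_iff_exists_real_btwn.1 hb
    obtain ⟨n, hn⟩ := exists_pow_lt_of_lt_one hε h1
    obtain ⟨k, hk, z, hz, hx, hx', hlt⟩ := h n N (c - a) (sub_pos.2 (EReal.coe_lt_coe_iff.1 hac))
    refine ⟨k, hk, fun i => z i, hz.isPath h0 h1 hx hx' hn, lt_trans ?_ hcb⟩
    rw [action_eq_chainAction]
    exact EReal.coe_lt_coe_iff.2 (by linarith)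

theorem IsSubaction.sub_le_chainAction {u : Shift M → ℝ} (hu : IsSubaction A u) {k : ℕ}
    {z : ℕ → NatExt M} (hz : IsChain k z) :
    u (proj (z k)) - u (proj (z 0)) ≤ chainAction A k z := by
  rw [← Finset.sum_range_sub (fun i => u (proj (z i)))]
  refine Finset.sum_le_sum fun i hi => ?_
  rw [hz i (Finset.mem_range.1 hi)]
  exact hu.2 _

theorem IsSubaction.sub_le_of_costLE {u : Shift M → ℝ} (hu : IsSubaction A u) {x x' : Shift M}
    {a : ℝ} (h : CostLE A x x' a) : u x' - u x ≤ a := by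
  refine le_of_forall_pos_le_add fun δ hδ => ?_
  obtain ⟨m, hm⟩ := exists_agree_abs_sub_lt hu.1 x (δ := δ / 3) (by positivity)
  obtain ⟨m', hm'⟩ := exists_agree_abs_sub_lt hu.1 x' (δ := δ / 3) (by positivity)
  obtain ⟨k, -, z, hz, hx, hx', hlt⟩ := h (max m m') 0 (δ / 3) (by positivity)
  have e1 := abs_lt.1 (hm _ (hx.mono (le_max_left _ _)))
  have e2 := abs_lt.1 (hm' _ (hx'.mono (le_max_right _ _)))
  have e3 := hu.sub_le_chainAction hz
  linarith

theorem IsSubaction.sub_le_peierls (h0 : 0 < lam) (h1 : lam < 1) {u : Shift M → ℝ}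
    (hu : IsSubaction A u) (x x' : Shift M) :
    ((u x' - u x : ℝ) : EReal) ≤ peierls lam A x x' := by
  by_contra! hlt
  obtain ⟨c, hc, hlt⟩ := EReal.lt_iff_exists_real_btwn.1 hlt
  have := hu.sub_le_of_costLE ((peierls_le_coe_iff h0 h1).1 hc.le)
  exact absurd (EReal.coe_lt_coe_iff.1 hlt) this.not_gt

/-- The two barriers are bounded below by opposite numbers, so a zero sum forces equality in both
bounds. -/
theorem costLE_of_peierls_add_eq_zero (h0 : 0 < lam) (h1 : lam < 1) {u : Shift M → ℝ}
    (hu : IsSubaction A u) {x x' : Shift M}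
    (h : peierls lam A x x' + peierls lam A x' x = 0) :
    CostLE A x x' (u x' - u x) ∧ CostLE A x' x (u x - u x') := by
  rw [← peierls_le_coe_iff h0 h1, ← peierls_le_coe_iff h0 h1]
  have e1 := hu.sub_le_peierls h0 h1 x x'
  have e2 := hu.sub_le_peierls h0 h1 x' x
  generalize peierls lam A x x' = p at *
  generalize peierls lam A x' x = q at *
  -- The lower bounds exclude `⊥`, and then the zero sum excludes `⊤`.
  induction p <;> induction q <;> simp_all
  norm_cast at *
  constructor <;> linarith

end Paths

/-! ### Shadowing and the triangle inequality -/

section Shadowing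

variable {A : NatExt M → ℝ} {lam : ℝ}

/-- The point of the natural extension with the past of `z` and the future `w`. -/
def replaceFuture (z : NatExt M) (w : Shift M) (h : (proj z).1 0 = w.1 0) : NatExt M :=
  ⟨(z.1.1, w), by have := z.2; rwa [show z.1.2.1 0 = w.1 0 from h] at this⟩

theorem IsHolder.exists_geometric (h0 : 0 < lam) (h1 : lam < 1) (hA : IsHolder lam A) :
    ∃ K β : ℝ, 0 ≤ K ∧ 0 < β ∧ β < 1 ∧ ∀ (n : ℕ) (z : NatExt M) (w : Shift M)
      (h : (proj z).1 0 = w.1 0), Agree n (proj z) w →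
        |A (replaceFuture z w h) - A z| ≤ K * β ^ n := by
  obtain ⟨θ, hθ, K, hK⟩ := hA
  refine ⟨|K|, lam ^ θ, abs_nonneg _, Real.rpow_pos_of_pos h0 θ,
    Real.rpow_lt_one h0.le h1 hθ, fun n z w h hzw => ?_⟩
  have hd : natExtDist lam (replaceFuture z w h) z ≤ lam ^ n := by
    refine max_le ?_ (seqDist_le_pow h0 h1 hzw.symm)
    exact seqDist_le_pow h0 h1 fun _ _ => rfl
  have hd0 : 0 ≤ natExtDist lam (replaceFuture z w h) z := by
    refine le_max_of_le_left ?_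
    unfold seqDist
    split_ifs <;> positivity
  calc |A (replaceFuture z w h) - A z| ≤ K * natExtDist lam (replaceFuture z w h) z ^ θ := hK _ _
    _ ≤ |K| * (lam ^ n) ^ θ := by
        gcongr
        exact le_abs_self K
    _ = |K| * (lam ^ θ) ^ n := by
        rw [← Real.rpow_natCast, ← Real.rpow_natCast, ← Real.rpow_mul h0.le,
          ← Real.rpow_mul h0.le, mul_comm (n : ℝ) θ]

/-- The contraction behind shadowing: prepending the same letter gains one letter of agreement. -/
theorem Agree.tau {n : ℕ} {z : NatExt M} {w : Shift M} {h : (proj z).1 0 = w.1 0}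
    (hzw : Agree n (proj z) w) : Agree (n + 1) (SFT.tau z) (SFT.tau (replaceFuture z w h)) := by
  intro i hi
  cases i with
  | zero => rfl
  | succ i => exact hzw i (by omega)

/-- A path that ends near `w` is shadowed by a path that ends at `w`. -/
theorem exists_shadowing {K β : ℝ} (hβ0 : 0 < β) (hβ1 : β < 1) (hK0 : 0 ≤ K)
    (hK : ∀ (n : ℕ) (z : NatExt M) (w : Shift M) (h : (proj z).1 0 = w.1 0),
      Agree n (proj z) w → |A (replaceFuture z w h) - A z| ≤ K * β ^ n)
    (k : ℕ) {n : ℕ} (hn : 1 ≤ n) (z : ℕ → NatExt M) (hz : IsChain k z) (w : Shift M)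
    (hw : Agree n (proj (z k)) w) :
    ∃ z' : ℕ → NatExt M, IsChain k z' ∧ proj (z' k) = w ∧ Agree n (proj (z' 0)) (proj (z 0)) ∧
      |chainAction A k z' - chainAction A k z| ≤ K * β ^ n / (1 - β) := by
  have hβ : 0 < 1 - β := sub_pos.2 hβ1
  induction k generalizing n w with
  | zero =>
    refine ⟨fun _ => replaceFuture (z 0) w (hw 0 hn), fun i hi => absurd hi (by omega), rfl,
      hw.symm, ?_⟩
    simp only [chainAction, Finset.range_zero, Finset.sum_empty, sub_self, abs_zero]
    positivity
  | succ k ih =>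
    -- The pasts are kept and the futures replaced, from the end of the path backwards.
    set y := replaceFuture (z (k + 1)) w (hw 0 hn) with hy
    have hyA := hK n _ w (hw 0 hn) hw
    obtain ⟨z', hz', hk, hz0, hz'A⟩ := ih (n := n + 1) (by omega)
      (fun i hi => hz i (by omega)) (tau y) (by
        rw [hz k (by omega)]
        exact hw.tau)
    refine ⟨join k z' fun i => if i = 0 then z' k else y,
      hz'.join (l := 1) (fun i hi => ?_) rfl, ?_, ?_, ?_⟩
    · obtain rfl : i = 0 := by omega
      simpa using hk
    · rw [proj_join_add (by simp) 1]
      rfl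
    · rw [join_of_le (Nat.zero_le k)]
      exact hz0.mono (Nat.le_succ n)
    · have hone : chainAction A 1 (fun i => if i = 0 then z' k else y) = A y - minValue A := by
        simp [chainAction]
      have hsum' : chainAction A (k + 1) z =
          chainAction A k z + (A (z (k + 1)) - minValue A) := Finset.sum_range_succ _ _
      -- The bound is the tail of a geometric series: the last step contributes `K * β ^ n`, and the
      -- shorter path, which agrees on `n + 1` letters, the rest.
      have hgeom : K * β ^ n / (1 - β) = K * β ^ (n + 1) / (1 - β) + K * β ^ n := by
        field_simp
        ring
      rw [chainAction_join, hone, hsum', hgeom]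
      calc _ = |(chainAction A k z' - chainAction A k z) + (A y - A (z (k + 1)))| := by
            congr 1; ring
        _ ≤ _ := (abs_add_le _ _).trans (add_le_add hz'A hyA)

/-- The first path ends only near the start of the second, so it is shadowed by one that ends
exactly there. -/
theorem CostLE.trans (h0 : 0 < lam) (h1 : lam < 1) (hA : IsHolder lam A) {x x' x'' : Shift M}
    {a b : ℝ} (h : CostLE A x x' a) (h' : CostLE A x' x'' b) : CostLE A x x'' (a + b) := by
  obtain ⟨K, β, hK0, hβ0, hβ1, hK⟩ := hA.exists_geometric h0 h1
  intro n N δ hδ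
  have hlim : Tendsto (fun m : ℕ => K * β ^ m / (1 - β)) atTop (𝓝 0) := by
    simpa using ((tendsto_pow_atTop_nhds_zero_of_lt_one hβ0.le hβ1).const_mul K).div_const (1 - β)
  obtain ⟨m, hm, hmn⟩ := ((hlim.eventually_lt_const (show 0 < δ / 3 by positivity)).and
    (eventually_ge_atTop (max n 1))).exists
  have hnm : n ≤ m := (le_max_left _ _).trans hmn
  obtain ⟨k, hk, z, hz, hzx, hzx', hzA⟩ := h m N (δ / 3) (by positivity)
  obtain ⟨l, -, w, hw, hwx, hwx', hwA⟩ := h' m 0 (δ / 3) (by positivity)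
  obtain ⟨z', hz', hz'k, hz'0, hz'A⟩ := exists_shadowing hβ0 hβ1 hK0 hK k
    ((le_max_right _ _).trans hmn) z hz (proj (w 0)) (hzx'.trans hwx.symm)
  refine ⟨k + l, by omega, join k z' w, hz'.join hw hz'k, ?_, ?_, ?_⟩
  · rw [join_of_le (Nat.zero_le k)]
    exact (hz'0.trans hzx).mono hnm
  · rw [proj_join_add hz'k]
    exact hwx'.mono hnm
  · have := (abs_le.1 hz'A).2
    rw [chainAction_join]
    linarith

end Shadowing

/-! ### Calibrated sub-actions and irreducible components -/

section Calibrated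

variable {A : NatExt M → ℝ} {lam : ℝ}

theorem isClosed_setOf_costLE {u : Shift M → ℝ} (hu : Continuous u) (p : Shift M) :
    IsClosed {q | CostLE A p q (u q - u p)} := by
  refine isClosed_of_closure_subset fun q hq n N δ hδ => ?_
  have hev : ∀ᶠ q' in 𝓝 q, Agree n q' q ∧ u q' < u q + δ / 2 :=
    (eventually_agree n q).and (hu.continuousAt.eventually_lt_const (by linarith))
  obtain ⟨q', ⟨hqn, hqu⟩, hq'⟩ := mem_closure_iff_nhds.1 hq _ hev
  obtain ⟨k, hk, z, hz, hx, hx', hlt⟩ := hq' n N (δ / 2) (by positivity)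
  exact ⟨k, hk, z, hz, hx, hx'.trans hqn, by linarith⟩

/-- A calibrated sub-action is propagated from a non-wandering point, and along the way the
difference with any other sub-action does not decrease. -/
theorem IsCalibrated.exists_nonwandering (h0 : 0 < lam) (h1 : lam < 1) {u v : Shift M → ℝ}
    (hu : IsCalibrated A u) (hv : IsSubaction A v) (x : Shift M) :
    ∃ p ∈ nonwandering lam A, CostLE A p x (u x - u p) ∧ u p - v p ≤ u x - v x := by
  choose g hg hgA using fun x => (hu.2 x).1
  have hcont := hu.1.1
  -- The backward orbit that attains the calibration minimum at each step. Paths run towards `x`, so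
  -- it is read in reverse below.
  set X : ℕ → Shift M := fun n => (fun x => tau (g x))^[n] x with hX
  have hX0 : X 0 = x := rfl
  have hXs (n : ℕ) : X (n + 1) = tau (g (X n)) := Function.iterate_succ_apply' _ _ _
  have hchain (m k : ℕ) : IsChain k fun i => g (X (m + k - i)) := by
    intro i hi
    rw [hg, ← hXs]
    congr 1; omega
  have haction (m k : ℕ) :
      chainAction A k (fun i => g (X (m + k - i))) = u (X m) - u (X (m + k)) := by
    have htel := Finset.sum_range_sub (fun i => u (X (m + k - i))) k
    simp only [Nat.add_sub_cancel, Nat.sub_zero] at htel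
    rw [← htel]
    refine Finset.sum_congr rfl fun i hi => ?_
    have hi := Finset.mem_range.1 hi
    have e := hgA (X (m + k - (i + 1)))
    rw [← hXs, show m + k - (i + 1) + 1 = m + k - i by omega] at e
    linarith
  have hmono (n : ℕ) : u (X n) - v (X n) ≤ u x - v x := by
    induction n with
    | zero => rfl
    | succ n ih =>
      have e1 := hgA (X n)
      have e2 := hv.2 (g (X n))
      rw [hg, ← hXs] at e2
      rw [← hXs] at e1
      linarith
  obtain ⟨p, hp⟩ : ∃ p, MapClusterPt p atTop X := exists_clusterPt_of_compactSpace _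
  have hnear (n : ℕ) {δ : ℝ} (hδ : 0 < δ) (N : ℕ) :
      ∃ k ≥ N, Agree n (X k) p ∧ |u (X k) - u p| < δ := by
    have hev := (eventually_agree n p).and (Metric.tendsto_nhds.1 hcont.continuousAt δ hδ)
    exact Filter.frequently_atTop.1 (hp.frequently hev) N
  refine ⟨p, fun ε hε => ?_, fun n N δ hδ => ?_, ?_⟩
  -- Two visits close to `p` bound a near-loop whose action is a difference of two values of `u`
  -- close to `u p`.
  · obtain ⟨n, hn⟩ := exists_pow_lt_of_lt_one hε h1
    obtain ⟨m, -, hm, hmu⟩ := hnear n (half_pos hε) 0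
    obtain ⟨l, hl, hln, hlu⟩ := hnear n (half_pos hε) (m + 1)
    obtain ⟨k, rfl⟩ := Nat.exists_eq_add_of_le (show m ≤ l by omega)
    refine ⟨k, by omega, _, (hchain m k).isPath h0 h1 (n := n) ?_ ?_ hn, ?_⟩
    · simpa [hg] using hln
    · simpa [hg] using hm
    · rw [action_eq_chainAction k fun i => g (X (m + k - i)), haction]
      rw [abs_lt] at *
      constructor <;> linarith
  · obtain ⟨k, hk, hkn, hku⟩ := hnear n hδ N
    refine ⟨k, hk, _, hchain 0 k, ?_, ?_, ?_⟩
    · simpa [hg] using hkn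
    · simpa [hg, hX0] using Agree.refl n x
    · rw [haction, zero_add, hX0]
      linarith [(abs_lt.1 hku).1]
  · have hclosed : IsClosed {q | u q - v q ≤ u x - v x} :=
      isClosed_le (hcont.sub hv.1) continuous_const
    by_contra hlt
    obtain ⟨n, hn⟩ := (hp.frequently (hclosed.isOpen_compl.mem_nhds hlt)).exists
    exact hn (hmono n)

theorem IsComponent.costLE (h0 : 0 < lam) (h1 : lam < 1) (hA : IsHolder lam A)
    {u : Shift M → ℝ} (hu : IsSubaction A u) {C : Set (Shift M)} (hC : IsComponent lam A C)
    {x x' : Shift M} (hx : x ∈ C) (hx' : x' ∈ C) : CostLE A x x' (u x' - u x) := by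
  obtain ⟨y, -, rfl⟩ := hC
  have e := (costLE_of_peierls_add_eq_zero h0 h1 hu hx.2).2.trans h0 h1 hA
    (costLE_of_peierls_add_eq_zero h0 h1 hu hx'.2).1
  rwa [show u y - u x + (u x' - u y) = u x' - u x by ring] at e

/-- Within a component the increment of `v` is an achievable cost, hence bounds the increment of
`u`, in both directions. -/
theorem IsComponent.sub_eq_sub (h0 : 0 < lam) (h1 : lam < 1) (hA : IsHolder lam A)
    {u v : Shift M → ℝ} (hu : IsSubaction A u) (hv : IsSubaction A v) {C : Set (Shift M)}
    (hC : IsComponent lam A C) {x x' : Shift M} (hx : x ∈ C) (hx' : x' ∈ C) :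
    u x - v x = u x' - v x' := by
  have e1 := hu.sub_le_of_costLE (hC.costLE h0 h1 hA hv hx hx')
  have e2 := hu.sub_le_of_costLE (hC.costLE h0 h1 hA hv hx' hx)
  linarith

theorem IsCalibrated.exists_isLeast (h0 : 0 < lam) (h1 : lam < 1) [Nonempty (Shift M)]
    {u v : Shift M → ℝ} (hu : IsCalibrated A u) (hv : IsSubaction A v) :
    ∃ m : ℝ, IsLeast (Set.range fun x => u x - v x) m ∧
      IsLeast ((fun x => u x - v x) '' nonwandering lam A) m := by
  obtain ⟨x, -, hx⟩ := isCompact_univ.exists_isMinOn (Set.univ_nonempty (α := Shift M))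
    (hu.1.1.sub hv.1).continuousOn
  have hmin : ∀ x', u x - v x ≤ u x' - v x' := fun x' => hx (Set.mem_univ x')
  obtain ⟨p, hp, -, hpx⟩ := hu.exists_nonwandering h0 h1 hv x
  refine ⟨u x - v x, ⟨⟨x, rfl⟩, ?_⟩, ⟨p, hp, le_antisymm hpx (hmin p)⟩, ?_⟩
  · rintro _ ⟨x', rfl⟩
    exact hmin x'
  · rintro _ ⟨x', -, rfl⟩
    exact hmin x'

/-- If all components other than `C i₁` fail to be local minima of `u - v`, then `u` is
propagated from `C i₁`. -/
theorem IsCalibrated.exists_costLE_of_not_isLocalMinSet (h0 : 0 < lam) (h1 : lam < 1)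
    (hA : IsHolder lam A) {u v : Shift M → ℝ} (hu : IsCalibrated A u) (hv : IsSubaction A v)
    {ι : Type*} [Finite ι] {C : ι → Set (Shift M)} (hC : ∀ i, IsComponent lam A (C i))
    (hΩ : nonwandering lam A = ⋃ i, C i) {i₁ : ι}
    (hloc : ∀ i, i ≠ i₁ → ¬ IsLocalMinSet (fun x => u x - v x) (C i)) (x : Shift M) :
    ∃ p ∈ C i₁, CostLE A p x (u x - u p) := by
  have hconst {i : ι} {p p' : Shift M} (hp : p ∈ C i) (hp' : p' ∈ C i) :
      u p - v p = u p' - v p' := (hC i).sub_eq_sub h0 h1 hA hu.1 hv hp hp'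
  have htrans {p q r : Shift M} (hpq : CostLE A p q (u q - u p))
      (hqr : CostLE A q r (u r - u q)) : CostLE A p r (u r - u p) := by
    have e := hpq.trans h0 h1 hA hqr
    rwa [show u q - u p + (u r - u q) = u r - u p by ring] at e
  have hsource (q : Shift M) : ∃ i, ∃ p ∈ C i, CostLE A p q (u q - u p) ∧
      u p - v p ≤ u q - v q := by
    obtain ⟨p, hp, hpq⟩ := hu.exists_nonwandering h0 h1 hv q
    rw [hΩ] at hp
    obtain ⟨i, hi⟩ := Set.mem_iUnion.1 hp
    exact ⟨i, p, hi, hpq⟩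
  -- a source of `x` with the smallest value of `u - v`
  obtain ⟨i, p, hp, hpx, hmin⟩ : ∃ i, ∃ p ∈ C i, CostLE A p x (u x - u p) ∧
      ∀ j, ∀ p' ∈ C j, CostLE A p' x (u x - u p') → u p - v p ≤ u p' - v p' := by
    let T : Set ι := {i | ∃ p ∈ C i, CostLE A p x (u x - u p)}
    have hT : ∀ i ∈ T, ∃ p ∈ C i, CostLE A p x (u x - u p) := fun _ h => h
    have : Nonempty (Shift M) := ⟨x⟩
    choose! rep hrep hrepx using hT
    obtain ⟨i₀, p₀, hp₀, hp₀x, -⟩ := hsource x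
    obtain ⟨i, hi, hmin⟩ := T.toFinite.exists_minimalFor (fun i => u (rep i) - v (rep i)) T
      ⟨i₀, p₀, hp₀, hp₀x⟩
    refine ⟨i, rep i, hrep i hi, hrepx i hi, fun j p' hp' hp'x => ?_⟩
    have hj : j ∈ T := ⟨p', hp', hp'x⟩
    rw [hconst hp' (hrep j hj)]
    exact (le_total _ _).elim id (hmin hj)
  obtain rfl | hi := eq_or_ne i i₁
  · exact ⟨p, hp, hpx⟩
  refine absurd ?_ (hloc i hi)
  -- The points that have a source with a value of `u - v` strictly below that of `C i`. Its
  -- complement will be the neighbourhood showing that `C i` is a local minimum.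
  let F : Set (Shift M) :=
    ⋃ j, {q | ∃ p' ∈ C j, u p' - v p' < u p - v p ∧ CostLE A p' q (u q - u p')}
  have hF : IsClosed F := by
    refine isClosed_iUnion_of_finite fun j => ?_
    by_cases hj : ∃ p' ∈ C j, u p' - v p' < u p - v p
    · obtain ⟨p', hp', hlt⟩ := hj
      convert isClosed_setOf_costLE (A := A) hu.1.1 p' using 1
      ext q
      refine ⟨fun ⟨p'', hp'', _, hq⟩ => ?_, fun hq => ⟨p', hp', hlt, hq⟩⟩
      -- One representative `p'` serves for the whole component, so only finitely many closed sets
      -- are united.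
      exact htrans ((hC j).costLE h0 h1 hA hu.1 hp' hp'') hq
    · convert isClosed_empty
      refine Set.eq_empty_of_forall_notMem fun q ⟨p', hp', hlt, _⟩ => hj ⟨p', hp', hlt⟩
  refine ⟨Fᶜ, hF.isOpen_compl, fun p'' hp'' hmem => ?_, fun p'' hp'' q hq => ?_⟩
  -- A point of `C i` in `F` would pass its lower source on to `x`, through `p`.
  · obtain ⟨j, p', hp', hlt, hp'p''⟩ := Set.mem_iUnion.1 hmem
    have := hmin j p' hp'
      (htrans hp'p'' (htrans ((hC i).costLE h0 h1 hA hu.1 hp'' hp) hpx))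
    linarith
  · change u p'' - v p'' ≤ u q - v q
    rw [hconst hp'' hp]
    by_contra! hlt
    obtain ⟨j, p', hp', hp'q, hle⟩ := hsource q
    exact hq (Set.mem_iUnion.2 ⟨j, p', hp', hle.trans_lt hlt, hp'q⟩)

end Calibrated

end SFT

theorem mainTheorem5 {s : ℕ} (hs : 1 ≤ s) (M : Matrix (Fin s) (Fin s) ℕ)
    (hM : SFT.IsTransitionMatrix M) (hirr : SFT.IsIrreducible M)
    (lam : ℝ) (hlam0 : 0 < lam) (hlam1 : lam < 1)
    (A : SFT.NatExt M → ℝ) (hA : SFT.IsHolder lam A)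
    (v u : SFT.Shift M → ℝ) (hv : SFT.IsSubaction A v) (hu : SFT.IsCalibrated A u) :
    -- the difference is constant on every irreducible component
    (∀ C : Set (SFT.Shift M), SFT.IsComponent lam A C →
      ∀ x ∈ C, ∀ x' ∈ C, u x - v x = u x' - v x') ∧
    -- both minima exist and they are equal
    (∃ m : ℝ, IsLeast (Set.range fun x => u x - v x) m ∧
      IsLeast ((fun x => u x - v x) '' SFT.nonwandering lam A) m) ∧
    -- finitely many components
    (∀ (r : ℕ) (C : Fin r → Set (SFT.Shift M)),
      (∀ i, SFT.IsComponent lam A (C i)) →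
      Pairwise (fun i j => Disjoint (C i) (C j)) →
      SFT.nonwandering lam A = ⋃ i, C i →
      ∀ i₁ : Fin r,
        (∀ i, (∃ x ∈ C i, ∀ x', u x - v x ≤ u x' - v x') ↔ i = i₁) →
        (∀ i, i ≠ i₁ → ¬ SFT.IsLocalMinSet (fun x => u x - v x) (C i)) →
        ∀ xbar ∈ C i₁, ∀ x : SFT.Shift M,
          (u x : EReal) = (u xbar : EReal) + SFT.peierls lam A xbar x) := by
  have := SFT.nonempty_shift hs hM hirr
  refine ⟨fun C hC x hx x' hx' => hC.sub_eq_sub hlam0 hlam1 hA hu.1 hv hx hx',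
    hu.exists_isLeast hlam0 hlam1 hv, ?_⟩
  intro r C hC _ hΩ i₁ _ hloc xbar hxbar x
  obtain ⟨p, hp, hpx⟩ :=
    hu.exists_costLE_of_not_isLocalMinSet hlam0 hlam1 hA hv hC hΩ hloc x
  have hle := ((hC i₁).costLE hlam0 hlam1 hA hu.1 hxbar hp).trans hlam0 hlam1 hA hpx
  rw [show u p - u xbar + (u x - u p) = u x - u xbar by ring,
    ← SFT.peierls_le_coe_iff hlam0 hlam1] at hle
  rw [le_antisymm hle (hu.1.sub_le_peierls hlam0 hlam1 xbar x), ← EReal.coe_add]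
  congr 1
  ring
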